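/- Let $\psi(x)=\Gamma'(x)/\Gamma(x)$ $(x>0)$ be the digamma function, let $\psi'$ be its derivative, and for integers $m\ge 1$, $k\ge 0$ put $\varphi_k=\cos\left(\frac{(2k+1)\pi}{m}\right)$. Then for every even integer $m\ge 2$, $$ \begin{aligned} \int_0^1\frac{(x^2+1)\log(x^{4m}+1)}{x^4+1}\,dx &=\frac{m}{16}\left(\psi'(7/8)-\psi'(3/8)\right)-\frac{\pi^2 m\sqrt2}{8}+\frac{\pi m\sqrt2}{4}\log 2\\ &\quad+\frac{\pi\sqrt2}{4}\left\{\sum_{k=0}^{\frac m2-1}\log\left(1+\sqrt{\frac{1-\varphi_k}{2}}\right)+2\sum_{k=0}^{\frac m2-1}\log\left(\sqrt2+\sqrt{1+\sqrt{\frac{1-\varphi_k}{2}}}\right)\right\}, \end{aligned} $$ and for every odd integer $m\ge 1$, $$ \begin{aligned} \int_0^1\frac{(x^2+1)\log(x^{4m}+1)}{x^4+1}\,dx &=\frac{m}{16}\left(\psi'(7/8)-\psi'(3/8)\right)-\frac{\pi^2 m\sqrt2}{8}+\frac{\pi (m+2)\sqrt2}{4}\log 2\\ &\quad+\frac{\pi\sqrt2}{4}\left\{\sum_{k=0}^{\frac{m-3}{2}}\log\left(1+\sqrt{\frac{1-\varphi_k}{2}}\right)+2\sum_{k=0}^{\frac{m-3}{2}}\log\left(\sqrt2+\sqrt{1+\sqrt{\frac{1-\varphi_k}{2}}}\right)\right\},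 \end{aligned} $$ where for $m=1$ the empty sums $\sum_{k=0}^{-1}$ are zero. -/

import Mathlib

/-- The digamma function `ψ(x) = Γ'(x) / Γ(x)` of a real variable `x > 0`. -/
noncomputable def psi (x : ℝ) : ℝ := deriv Real.Gamma x / Real.Gamma x

/-- `φ_k = cos ((2k+1)π / m)`. -/
noncomputable def phi (m k : ℕ) : ℝ := Real.cos ((2 * (k : ℝ) + 1) * Real.pi / (m : ℝ))

/-!
Write `w(x) = (x ^ 2 + 1) / (x ^ 4 + 1)`. The function `θ(x) = arctan (√2 x + 1) + arctan (√2 x - 1)`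
satisfies `θ' = √2 w`, maps `[0, 1]` onto `[0, π / 2]`, and has
`sin θ = √2 x / √(x ^ 4 + 1)`, `cos θ = (1 - x ^ 2) / √(x ^ 4 + 1)`. The Chebyshev factorization
(`pow_add_one_eq_prod`) writes `x ^ (4 m) + 1` as the product over `j < m` of
`x ^ 4 + 1 - 2 cos β_j x ^ 2`, where `β_j = (2 j + 1) π / (2 m)`, and each factor equals
`(x ^ 4 + 1) (cos² θ + b_j² sin² θ)` with `b_j = √2 sin (β_j / 2)` (`quartic_factor_eq`).

Taking logarithms, the integral becomes `m ∫ w log (x ^ 4 + 1)` plus the integrals of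
`log (cos² t + b_j² sin² t) / √2` over `[0, π / 2]`. The latter equal `π log ((1 + b_j) / 2) / √2` by
the mean value property of `log ‖1 + q z‖` (`integral_log_cos_sq_add_mul_sin_sq`). The former is
reduced by the same substitution and the value of `∫ log sin` to `2 ∫ w log x`
(`integral_weight_mul_log_quartic`). Together these give `integral_eq_sum_log`.

Expanding `w` in powers of `x ^ 8` turns `∫ w log x` into values of `ψ'` at odd multiples of `1 / 8`
(`integral_mul_log_eq_deriv_psi`), using `ψ' x = ∑ 1 / (n + x) ^ 2` (`hasDerivAt_psi`). The
reflection formula for `ψ'` leaves only `ψ' (3 / 8)` and `ψ' (7 / 8)`.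

Finally `β_k` and `β_{m - 1 - k} = π - β_k` are paired through
`(√2 + 2 sin (β / 2)) (√2 + 2 cos (β / 2)) = 2 √(1 + sin β) (√2 + √(1 + sin β))`
(`log_add_log_complementary`), with `sin β_k = √((1 - φ_k) / 2)`. For odd `m` the middle node
`β = π / 2` remains and contributes `log (2 √2)`.
-/

open Real Filter Topology Set MeasureTheory

/-! ### The trigamma function as a series, and its reflection formula -/

theorem hasDerivAt_log_Gamma {x : ℝ} (hx : 0 < x) :
    HasDerivAt (fun y => log (Gamma y)) (psi x) x :=
  ((differentiableAt_Gamma fun m => by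
    have : (0 : ℝ) ≤ m := m.cast_nonneg
    linarith).hasDerivAt).log (Gamma_pos_of_pos hx).ne'

theorem psi_add_one {x : ℝ} (hx : 0 < x) : psi (x + 1) = psi x + 1 / x := by
  have h1 : HasDerivAt (fun y => log (Gamma (y + 1))) (psi (x + 1)) x :=
    (hasDerivAt_log_Gamma (by positivity : 0 < x + 1)).comp_add_const x 1
  have h2 : HasDerivAt (fun y => log (Gamma y) + log y) (psi x + 1 / x) x := by
    rw [one_div]
    exact (hasDerivAt_log_Gamma hx).add (hasDerivAt_log hx.ne')
  refine h1.unique (h2.congr_of_eventuallyEq ?_)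
  filter_upwards [eventually_gt_nhds hx] with y hy
  rw [Gamma_add_one hy.ne', log_mul hy.ne' (Gamma_pos_of_pos hy).ne', add_comm]

theorem psi_add_nat {x : ℝ} (hx : 0 < x) (N : ℕ) :
    psi (x + N) = psi x + ∑ n ∈ Finset.range N, 1 / ((n : ℝ) + x) := by
  induction N with
  | zero => simp
  | succ N ih =>
    rw [Finset.sum_range_succ, ← add_assoc, ← ih, Nat.cast_succ, ← add_assoc,
      psi_add_one (by positivity), add_comm x]

theorem log_le_psi_add_one {x : ℝ} (hx : 0 < x) : log x ≤ psi (x + 1) := by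
  have hd := hasDerivAt_log_Gamma (by positivity : 0 < x + 1)
  have h := convexOn_log_Gamma.slope_le_deriv (mem_Ioi.mpr hx)
    (mem_Ioi.mpr (by positivity : 0 < x + 1)) (by linarith) hd.differentiableAt
  have hd' : deriv (log ∘ Gamma) (x + 1) = psi (x + 1) := hd.deriv
  rw [hd', slope_def_field] at h
  simpa [Gamma_add_one hx.ne', log_mul hx.ne' (Gamma_pos_of_pos hx).ne'] using h

theorem psi_le_log {x : ℝ} (hx : 0 < x) : psi x ≤ log x := by
  have hd := hasDerivAt_log_Gamma hx
  have h := convexOn_log_Gamma.deriv_le_slope (mem_Ioi.mpr hx)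
    (mem_Ioi.mpr (by positivity : 0 < x + 1)) (by linarith) hd.differentiableAt
  have hd' : deriv (log ∘ Gamma) x = psi x := hd.deriv
  rw [hd', slope_def_field] at h
  simpa [Gamma_add_one hx.ne', log_mul hx.ne' (Gamma_pos_of_pos hx).ne'] using h

theorem tendsto_psi_add_nat_sub_log {x : ℝ} (hx : 0 < x) :
    Tendsto (fun N : ℕ => psi (x + N) - log N) atTop (𝓝 0) := by
  have h1 := (tendsto_log_comp_add_sub_log (x - 1)).comp tendsto_natCast_atTop_atTop
  have h2 := (tendsto_log_comp_add_sub_log x).comp tendsto_natCast_atTop_atTop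
  refine tendsto_of_tendsto_of_tendsto_of_le_of_le' h1 h2 ?_ ?_
  · filter_upwards [eventually_ge_atTop 1] with N hN
    have hN' : (1 : ℝ) ≤ N := by exact_mod_cast hN
    have := log_le_psi_add_one (by linarith : 0 < (N : ℝ) + (x - 1))
    rw [show (N : ℝ) + (x - 1) + 1 = x + N by ring] at this
    simpa using this
  · filter_upwards with N
    have := psi_le_log (by positivity : 0 < x + N)
    rw [add_comm x] at this ⊢
    simpa using this

theorem summable_one_div_nat_add_sq {x : ℝ} (hx : 0 < x) :
    Summable fun n : ℕ => 1 / ((n : ℝ) + x) ^ 2 := by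
  have := (summable_one_div_nat_add_rpow x 2).mpr (by norm_num)
  refine this.congr fun n => ?_
  rw [abs_of_pos (by positivity)]
  norm_cast

/-- Termwise differentiation of `ψ z - ψ 1 = ∑ (1 / (n + 1) - 1 / (n + z))`, which holds because
log-convexity of `Γ` forces `ψ (z + N) - log N → 0`. -/
theorem hasDerivAt_psi {x : ℝ} (hx : 0 < x) :
    HasDerivAt psi (∑' n : ℕ, 1 / ((n : ℝ) + x) ^ 2) x := by
  -- The derivatives are dominated uniformly on `(δ, ∞)`, which must contain `x` and the base point `1`.
  obtain ⟨δ, hδ, hδx, hδ1⟩ : ∃ δ : ℝ, 0 < δ ∧ δ < x ∧ δ < 1 :=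
    ⟨min x 1 / 2, by positivity, by linarith [min_le_left x 1, lt_min hx one_pos],
      by linarith [min_le_right x 1]⟩
  have hg : ∀ (n : ℕ) (z : ℝ), z ∈ Ioi δ → HasDerivAt
      (fun z : ℝ => 1 / ((n : ℝ) + 1) - 1 / ((n : ℝ) + z)) (1 / ((n : ℝ) + z) ^ 2) z := by
    intro n z hz
    have hz : δ < z := hz
    have hz0 : 0 < z := hδ.trans hz
    have h0 : (n : ℝ) + z ≠ 0 := by positivity
    have := (((hasDerivAt_id z).const_add (n : ℝ)).inv h0).const_sub (1 / ((n : ℝ) + 1))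
    simp only [one_div, id_eq, neg_div, neg_neg] at this ⊢
    exact this
  have hg' : ∀ (n : ℕ) (z : ℝ), z ∈ Ioi δ →
      ‖1 / ((n : ℝ) + z) ^ 2‖ ≤ 1 / ((n : ℝ) + δ) ^ 2 := by
    intro n z hz
    have hz : δ < z := hz
    rw [Real.norm_of_nonneg (by positivity)]
    gcongr
  have hu := summable_one_div_nat_add_sq hδ
  have h0 : Summable fun n : ℕ => 1 / ((n : ℝ) + 1) - 1 / ((n : ℝ) + 1) := by
    simp
  have hD := hasDerivAt_tsum_of_isPreconnected hu isOpen_Ioi isPreconnected_Ioi hg hg'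
    (mem_Ioi.mpr hδ1) h0 (mem_Ioi.mpr hδx)
  refine (hD.const_add (psi 1)).congr_of_eventuallyEq ?_
  filter_upwards [eventually_gt_nhds hδx] with z hz
  have hs := summable_of_summable_hasDerivAt_of_isPreconnected hu isOpen_Ioi isPreconnected_Ioi
    hg hg' (mem_Ioi.mpr hδ1) h0 (mem_Ioi.mpr hz)
  have hz0 : 0 < z := hδ.trans hz
  have hlim := (tendsto_psi_add_nat_sub_log one_pos).sub (tendsto_psi_add_nat_sub_log hz0)
  have hlim' := hlim.add_const (psi z - psi 1)
  have := tendsto_nhds_unique hs.hasSum.tendsto_sum_nat (hlim'.congr fun N => ?_)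
  · rw [this]; ring
  · rw [psi_add_nat one_pos, psi_add_nat hz0, Finset.sum_sub_distrib]
    ring

theorem hasSum_deriv_psi {x : ℝ} (hx : 0 < x) :
    HasSum (fun n : ℕ => 1 / ((n : ℝ) + x) ^ 2) (deriv psi x) := by
  rw [(hasDerivAt_psi hx).deriv]
  exact (summable_one_div_nat_add_sq hx).hasSum

/-- The logarithmic derivative of Euler's reflection formula. -/
theorem psi_sub_psi_one_sub {x : ℝ} (hx : 0 < x) (hx1 : x < 1) :
    psi x - psi (1 - x) = -(π * (cos (π * x) / sin (π * x))) := by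
  have hs : ∀ y, 0 < y → y < 1 → 0 < sin (π * y) := fun y h0 h1 =>
    sin_pos_of_pos_of_lt_pi (by positivity) (by nlinarith [pi_pos])
  have h1 : HasDerivAt (fun y => log (Gamma y) + log (Gamma (1 - y))) (psi x - psi (1 - x)) x := by
    rw [sub_eq_add_neg]
    exact (hasDerivAt_log_Gamma hx).add
      ((hasDerivAt_log_Gamma (sub_pos.mpr hx1)).comp_const_sub 1 x)
  have h2 : HasDerivAt (fun y => log π - log (sin (π * y)))
      (-(π * (cos (π * x) / sin (π * x)))) x := by
    have := ((((hasDerivAt_id x).const_mul π).sin).log (hs x hx hx1).ne').const_sub (log π)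
    convert! this using 1
    simp only [id_eq]
    ring
  refine h1.unique (h2.congr_of_eventuallyEq ?_)
  filter_upwards [eventually_gt_nhds hx, eventually_lt_nhds hx1] with y h0 h1
  rw [← log_mul (Gamma_pos_of_pos h0).ne' (Gamma_pos_of_pos (sub_pos.mpr h1)).ne',
    Gamma_mul_Gamma_one_sub, log_div pi_ne_zero (hs y h0 h1).ne']

/-- The derivative of the reflection formula for `ψ`. -/
theorem deriv_psi_add_deriv_psi_one_sub {x : ℝ} (hx : 0 < x) (hx1 : x < 1) :
    deriv psi x + deriv psi (1 - x) = π ^ 2 / sin (π * x) ^ 2 := by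
  have hs : sin (π * x) ≠ 0 :=
    (sin_pos_of_pos_of_lt_pi (by positivity) (by nlinarith [pi_pos])).ne'
  have hd : ∀ {y : ℝ}, 0 < y → HasDerivAt psi (deriv psi y) y := fun hy =>
    (hasDerivAt_psi hy).differentiableAt.hasDerivAt
  have h1 : HasDerivAt (fun y => psi y - psi (1 - y)) (deriv psi x + deriv psi (1 - x)) x := by
    rw [← sub_neg_eq_add]
    exact (hd hx).sub ((hd (sub_pos.mpr hx1)).comp_const_sub 1 x)
  have hl := (hasDerivAt_id x).const_mul π
  have h2 : HasDerivAt (fun y => -(π * (cos (π * y) / sin (π * y)))) (π ^ 2 / sin (π * x) ^ 2) x := by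
    have := ((hl.cos.div hl.sin hs).const_mul π).neg
    convert! this using 1
    simp only [id_eq]
    field_simp
    linear_combination (-1 : ℝ) * sin_sq_add_cos_sq (π * x)
  refine h1.unique (h2.congr_of_eventuallyEq ?_)
  filter_upwards [eventually_gt_nhds hx, eventually_lt_nhds hx1] with y h0 h1
  exact psi_sub_psi_one_sub h0 h1

theorem deriv_psi_one_eighth_sub_five_eighths :
    deriv psi (1 / 8) - deriv psi (5 / 8) =
      deriv psi (3 / 8) - deriv psi (7 / 8) + 4 * √2 * π ^ 2 := by
  have h1 := deriv_psi_add_deriv_psi_one_sub (x := 1 / 8) (by norm_num) (by norm_num)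
  have h3 := deriv_psi_add_deriv_psi_one_sub (x := 3 / 8) (by norm_num) (by norm_num)
  rw [show (1 : ℝ) - 1 / 8 = 7 / 8 by norm_num] at h1
  rw [show (1 : ℝ) - 3 / 8 = 5 / 8 by norm_num] at h3
  have h2 : √2 ^ 2 = 2 := sq_sqrt (by norm_num)
  have e1 : sin (π * (1 / 8)) ^ 2 = (2 - √2) / 4 := by
    rw [sin_sq_eq_half_sub, show 2 * (π * (1 / 8)) = π / 4 by ring, cos_pi_div_four]; ring
  have e3 : sin (π * (3 / 8)) ^ 2 = (2 + √2) / 4 := by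
    rw [sin_sq_eq_half_sub, show 2 * (π * (3 / 8)) = π - π / 4 by ring, cos_pi_sub,
      cos_pi_div_four]; ring
  have hlt : √2 < 2 := by nlinarith [sqrt_nonneg 2]
  have hne : 2 - √2 ≠ 0 := by linarith
  have hne' : 2 + √2 ≠ 0 := by positivity
  have : π ^ 2 / ((2 - √2) / 4) - π ^ 2 / ((2 + √2) / 4) = 4 * √2 * π ^ 2 := by
    field_simp
    linear_combination √2 * h2
  rw [e1] at h1
  rw [e3] at h3
  linarith

/-! ### The integral of `log x` against the weight -/

theorem intervalIntegrable_pow_mul_log (k : ℕ) :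
    IntervalIntegrable (fun x : ℝ => x ^ k * log x) volume 0 1 :=
  intervalIntegral.intervalIntegrable_log'.continuousOn_mul (by fun_prop)

theorem integral_pow_mul_log (k : ℕ) :
    ∫ x in (0 : ℝ)..1, x ^ k * log x = -(1 / ((k : ℝ) + 1) ^ 2) := by
  have hk : (k : ℝ) + 1 ≠ 0 := by positivity
  have hc : ContinuousOn (fun x : ℝ => x ^ k * (x * log x) / (k + 1) - x ^ (k + 1) / (k + 1) ^ 2)
      (Icc 0 1) :=
    (((continuous_pow k).mul continuous_mul_log).div_const _ |>.sub
      ((continuous_pow (k + 1)).div_const _)).continuousOn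
  have hd : ∀ x ∈ Ioo (0 : ℝ) 1, HasDerivAt
      (fun x : ℝ => x ^ k * (x * log x) / (k + 1) - x ^ (k + 1) / (k + 1) ^ 2)
      (x ^ k * log x) x := by
    intro x hx
    have h0 : x ≠ 0 := hx.1.ne'
    have h := (((hasDerivAt_pow (k + 1) x).mul (hasDerivAt_log h0)).div_const ((k : ℝ) + 1)).sub
      ((hasDerivAt_pow (k + 1) x).div_const (((k : ℝ) + 1) ^ 2))
    refine (h.congr_deriv ?_).congr_of_eventuallyEq (Eventually.of_forall fun y => ?_)
    · simp only [Nat.add_sub_cancel, Nat.cast_add, Nat.cast_one]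
      field_simp
      ring
    · simp only [Pi.mul_apply, Pi.sub_apply]
      ring
  rw [intervalIntegral.integral_eq_sub_of_hasDerivAt_of_le zero_le_one hc hd
    (intervalIntegrable_pow_mul_log k)]
  simp

/-- The value comes from expanding
`(x ^ 2 + 1) / (x ^ 4 + 1) = ∑ x ^ (8 n) (1 + x ^ 2) (1 - x ^ 4)`, a series of nonnegative terms. -/
theorem integral_mul_log_eq_deriv_psi :
    ∫ x in (0 : ℝ)..1, (x ^ 2 + 1) / (x ^ 4 + 1) * log x =
      -((deriv psi (1 / 8) + deriv psi (3 / 8) - deriv psi (5 / 8) - deriv psi (7 / 8)) / 64) := by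
  set F : ℕ → ℝ → ℝ := fun n x => x ^ (8 * n) * (1 + x ^ 2) * (1 - x ^ 4) * -log x with hF
  have hFe : ∀ n, F n = fun x => -(x ^ (8 * n) * log x) + -(x ^ (8 * n + 2) * log x)
      - -(x ^ (8 * n + 4) * log x) - -(x ^ (8 * n + 6) * log x) := by
    intro n; ext x; simp only [hF]; ring
  have hi : ∀ k : ℕ, IntervalIntegrable (fun x : ℝ => -(x ^ k * log x)) volume 0 1 :=
    fun k => (intervalIntegrable_pow_mul_log k).neg
  have hint : ∀ n, IntervalIntegrable (F n) volume 0 1 := by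
    intro n
    rw [hFe]
    exact (((hi _).add (hi _)).sub (hi _)).sub (hi _)
  have hval : ∀ n, ∫ x in (0 : ℝ)..1, F n x = (1 / ((n : ℝ) + 1 / 8) ^ 2 + 1 / ((n : ℝ) + 3 / 8) ^ 2
      - 1 / ((n : ℝ) + 5 / 8) ^ 2 - 1 / ((n : ℝ) + 7 / 8) ^ 2) / 64 := by
    intro n
    rw [hFe, intervalIntegral.integral_sub (((hi _).add (hi _)).sub (hi _)) (hi _),
      intervalIntegral.integral_sub ((hi _).add (hi _)) (hi _),
      intervalIntegral.integral_add (hi _) (hi _)]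
    simp only [intervalIntegral.integral_neg, integral_pow_mul_log]
    push_cast
    field_simp
    ring
  have hsum := ((((hasSum_deriv_psi (x := 1 / 8) (by norm_num)).add
    (hasSum_deriv_psi (x := 3 / 8) (by norm_num))).sub
    (hasSum_deriv_psi (x := 5 / 8) (by norm_num))).sub
    (hasSum_deriv_psi (x := 7 / 8) (by norm_num))).div_const 64
  have hnonneg : ∀ n, ∀ x ∈ Ioc (0 : ℝ) 1, 0 ≤ F n x := by
    intro n x hx
    have h1 : x ^ 4 ≤ 1 := pow_le_one₀ hx.1.le hx.2
    have h2 := log_nonpos hx.1.le hx.2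
    have h3 := hx.1.le
    exact mul_nonneg (mul_nonneg (by positivity) (by linarith)) (by linarith)
  have hval' : ∀ n, ∫ x in Ioc (0 : ℝ) 1, F n x = _ := fun n => by
    rw [← intervalIntegral.integral_of_le zero_le_one, hval n]
  have hnorm : ∀ n, ∫ x in Ioc (0 : ℝ) 1, ‖F n x‖ = ∫ x in Ioc (0 : ℝ) 1, F n x := fun n =>
    setIntegral_congr_fun measurableSet_Ioc fun x hx => Real.norm_of_nonneg (hnonneg n x hx)
  have hS := hasSum_integral_of_summable_integral_norm (μ := volume.restrict (Ioc (0 : ℝ) 1))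
    (F := F) (fun n => (intervalIntegrable_iff_integrableOn_Ioc_of_le zero_le_one).mp (hint n))
    (by simp_rw [hnorm, hval']; exact hsum.summable)
  simp_rw [hval'] at hS
  rw [hsum.unique hS, ← intervalIntegral.integral_of_le zero_le_one,
    ← intervalIntegral.integral_neg]
  refine intervalIntegral.integral_congr_ae ?_
  have h1 : ∀ᵐ x : ℝ, x ≠ 1 := by simp [ae_iff]
  filter_upwards [h1] with x hx1 hx
  rw [uIoc_of_le zero_le_one] at hx
  have hlt : x < 1 := lt_of_le_of_ne hx.2 hx1
  have h8 : x ^ 8 < 1 := pow_lt_one₀ hx.1.le hlt (by norm_num)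
  have hgeo := (hasSum_geometric_of_lt_one (by positivity [hx.1.le]) h8).mul_right
    ((1 + x ^ 2) * (1 - x ^ 4) * -log x)
  have hF' : (fun n => F n x) = fun n => (x ^ 8) ^ n * ((1 + x ^ 2) * (1 - x ^ 4) * -log x) := by
    ext n
    simp only [hF, ← pow_mul]
    ring
  rw [hF', hgeo.tsum_eq]
  have h9 : 1 - x ^ 8 ≠ 0 := by linarith
  field_simp
  ring

/-! ### Factorization of `x ^ (4 m) + 1` -/

/-- With `x ^ 2 = exp u`, this is the factorization of the Chebyshev polynomial
`T_m (cosh u) = cosh (m u)` over its roots. -/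
theorem pow_add_one_eq_prod {m : ℕ} (hm : m ≠ 0) {x : ℝ} (hx : 0 < x) :
    x ^ (4 * m) + 1 = ∏ j ∈ Finset.range m,
      (x ^ 4 + 1 - 2 * cos ((2 * j + 1) * π / (2 * m)) * x ^ 2) := by
  have hroots : (Polynomial.Chebyshev.T ℝ m).roots =
      (Finset.range m).val.map fun k : ℕ => cos ((2 * k + 1) * π / (2 * m)) := by
    rw [Polynomial.Chebyshev.roots_T_real, Finset.image_val_of_injOn]
    exact (Finset.range m).nodup_map_iff_injOn.mp (Polynomial.Chebyshev.roots_T_real_nodup m)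
  have hfac := Polynomial.C_leadingCoeff_mul_prod_multiset_X_sub_C
    (p := Polynomial.Chebyshev.T ℝ m) (by
      rw [hroots, Multiset.card_map, Polynomial.Chebyshev.natDegree_T]
      simp)
  have h := congrArg (Polynomial.eval (cosh (2 * log x))) hfac
  rw [Polynomial.Chebyshev.T_real_cosh, Polynomial.eval_mul, Polynomial.eval_C, hroots,
    Multiset.map_map, Polynomial.eval_multiset_prod, Multiset.map_map,
    Polynomial.Chebyshev.leadingCoeff_T] at h
  simp only [Function.comp_apply, Polynomial.eval_sub, Polynomial.eval_X, Polynomial.eval_C,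
    Int.natAbs_natCast, Int.cast_natCast] at h
  change _ * ∏ j ∈ Finset.range m, (cosh (2 * log x) - cos ((2 * j + 1) * π / (2 * m))) = _ at h
  have hc : ∀ k : ℕ, cosh (k * (2 * log x)) = (x ^ (2 * k) + (x ^ (2 * k))⁻¹) / 2 := by
    intro k
    rw [cosh_eq, exp_neg, show (k : ℝ) * (2 * log x) = (2 * k : ℕ) * log x by push_cast; ring,
      exp_nat_mul, exp_log hx]
  have hc1 : cosh (2 * log x) = (x ^ 2 + (x ^ 2)⁻¹) / 2 := by simpa using hc 1
  have hterm : ∀ j ∈ Finset.range m, x ^ 4 + 1 - 2 * cos ((2 * j + 1) * π / (2 * m)) * x ^ 2 =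
      2 * x ^ 2 * (cosh (2 * log x) - cos ((2 * j + 1) * π / (2 * m))) := by
    intro j _
    rw [hc1]
    field_simp
  rw [Finset.prod_congr rfl hterm, Finset.prod_mul_distrib, Finset.prod_const, Finset.card_range]
  rw [hc] at h
  obtain ⟨n, rfl⟩ := Nat.exists_eq_succ_of_ne_zero hm
  simp only [Nat.succ_eq_add_one, Nat.add_sub_cancel] at h ⊢
  have e : (2 * x ^ 2) ^ (n + 1) = x ^ (2 * (n + 1)) * (2 * 2 ^ n) := by
    rw [mul_pow, ← pow_mul, pow_succ 2 n]; ring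
  rw [e, mul_assoc, mul_assoc, h]
  field_simp
  ring

/-! ### The integral of `log (cos² + b² sin²)` -/

theorem cos_sq_add_mul_sin_sq_pos {b : ℝ} (hb : 0 < b) (t : ℝ) :
    0 < cos t ^ 2 + b ^ 2 * sin t ^ 2 := by
  rcases eq_or_ne (cos t) 0 with h | h
  · have : sin t ≠ 0 := fun h' => by simpa [h, h'] using sin_sq_add_cos_sq t
    positivity
  · positivity

/-- The mean value property at `0` of the harmonic function `log ‖1 + q z‖` with
`q = (1 - b) / (1 + b)`, since on the unit circle
`‖1 + q e ^ (2 i t)‖ ^ 2 = (cos t ^ 2 + b ^ 2 sin t ^ 2) / ((1 + b) / 2) ^ 2`. -/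
theorem integral_log_cos_sq_add_mul_sin_sq {b : ℝ} (hb : 0 < b) :
    ∫ t in (0 : ℝ)..π / 2, log (cos t ^ 2 + b ^ 2 * sin t ^ 2) = π * log ((1 + b) / 2) := by
  set q : ℝ := (1 - b) / (1 + b) with hq
  have hq1 : |q| < 1 := by
    rw [hq, abs_div, abs_of_pos (by positivity : 0 < 1 + b), div_lt_one (by positivity), abs_lt]
    constructor <;> linarith
  set g : ℝ → ℝ := fun t => log (cos t ^ 2 + b ^ 2 * sin t ^ 2) with hg
  have hpos := cos_sq_add_mul_sin_sq_pos hb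
  have hgc : Continuous g := by
    apply Continuous.log (by fun_prop)
    exact fun t => (hpos t).ne'
  have hnorm : ∀ θ : ℝ, log ‖1 + (q : ℂ) * circleMap 0 1 θ‖
      = g (θ / 2) / 2 - log ((1 + b) / 2) := by
    intro θ
    have e : ‖1 + (q : ℂ) * circleMap 0 1 θ‖ ^ 2 =
        (cos (θ / 2) ^ 2 + b ^ 2 * sin (θ / 2) ^ 2) / ((1 + b) / 2) ^ 2 := by
      have hz : 1 + (q : ℂ) * circleMap 0 1 θ = ⟨1 + q * cos θ, q * sin θ⟩ := by
        apply Complex.ext <;>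
        simp [circleMap, Complex.exp_re, Complex.exp_im]
      rw [← Complex.normSq_eq_norm_sq, hz, Complex.normSq_mk]
      obtain ⟨t, rfl⟩ : ∃ t, θ = 2 * t := ⟨θ / 2, by ring⟩
      have hcs := sin_sq_add_cos_sq (2 * t)
      have hc2 := cos_sq_add_sin_sq t
      have hc := cos_two_mul t
      rw [show 2 * t / 2 = t by ring]
      have hs : sin t ^ 2 = 1 - cos t ^ 2 := by linarith
      calc _ = 1 + 2 * q * cos (2 * t) + q ^ 2 := by linear_combination q ^ 2 * hcs
        _ = _ := by
          rw [hc, hs, hq]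
          field_simp
          ring
    have h2 := congrArg log e
    rw [log_div (hpos _).ne' (by positivity), log_pow, log_pow] at h2
    push_cast at h2
    simp only [hg]
    linarith
  have hmean : circleAverage (fun z : ℂ => log ‖1 + (q : ℂ) * z‖) 0 1 = 0 := by
    rw [InnerProductSpace.HarmonicOnNhd.circleAverage_eq]
    · simp
    intro x hx
    apply AnalyticAt.harmonicAt_log_norm (by fun_prop)
    intro h0
    have hx' : ‖x‖ ≤ 1 := by simpa using hx
    have : ‖(q : ℂ) * x‖ = 1 := by
      rw [show (q : ℂ) * x = -1 by linear_combination h0]; simp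
    rw [norm_mul, Complex.norm_real, Real.norm_eq_abs] at this
    nlinarith [norm_nonneg x, abs_nonneg q]
  rw [circleAverage_def] at hmean
  simp only [hnorm] at hmean
  have hint : ∀ a c : ℝ, IntervalIntegrable g volume a c := fun a c => hgc.intervalIntegrable a c
  rw [intervalIntegral.integral_sub
      ((by fun_prop : Continuous fun θ => g (θ / 2) / 2).intervalIntegrable _ _)
      intervalIntegrable_const, intervalIntegral.integral_div,
    intervalIntegral.integral_comp_div g (by norm_num), intervalIntegral.integral_const] at hmean
  have hsymm : ∫ t in (π / 2)..π, g t = ∫ t in (0 : ℝ)..π / 2, g t := by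
    have := intervalIntegral.integral_comp_sub_left (a := 0) (b := π / 2) g π
    rw [sub_zero, show π - π / 2 = π / 2 by ring] at this
    rw [← this]
    simp [hg]
  have hadd := intervalIntegral.integral_add_adjacent_intervals (hint 0 (π / 2)) (hint (π / 2) π)
  rw [hsymm] at hadd
  rw [zero_div, show 2 * π / 2 = π by ring, ← hadd] at hmean
  simp only [smul_eq_mul, mul_eq_zero, inv_eq_zero] at hmean
  rcases hmean with h | h
  · exact absurd h (by simp [pi_ne_zero])
  · linarith

/-! ### The substitution `θ(x)` -/

/-- The substitution `θ(x) = arctan (√2 x + 1) + arctan (√2 x - 1)`, an antiderivative of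
`√2 (x ^ 2 + 1) / (x ^ 4 + 1)`. On `[0, 1)` it is the angle with tangent `√2 x / (1 - x ^ 2)`, but
this form has no singularity at `x = 1`. -/
noncomputable def quarticAngle (x : ℝ) : ℝ := arctan (√2 * x + 1) + arctan (√2 * x - 1)

theorem hasDerivAt_quarticAngle (x : ℝ) :
    HasDerivAt quarticAngle (√2 * ((x ^ 2 + 1) / (x ^ 4 + 1))) x := by
  have h2 : √2 ^ 2 = 2 := sq_sqrt (by norm_num)
  have hl := (hasDerivAt_id x).const_mul √2
  refine ((hl.add_const 1).arctan.add (hl.sub_const 1).arctan).congr_deriv ?_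
  simp only [id_eq, mul_one]
  have e1 : 1 + (√2 * x + 1) ^ 2 = 2 * (x ^ 2 + √2 * x + 1) := by linear_combination x ^ 2 * h2
  have e2 : 1 + (√2 * x - 1) ^ 2 = 2 * (x ^ 2 - √2 * x + 1) := by linear_combination x ^ 2 * h2
  have p1 : x ^ 2 + √2 * x + 1 ≠ 0 := by nlinarith [sq_nonneg (√2 * x + 1), sq_nonneg x]
  have p2 : x ^ 2 - √2 * x + 1 ≠ 0 := by nlinarith [sq_nonneg (√2 * x - 1), sq_nonneg x]
  have e3 : x ^ 4 + 1 = (x ^ 2 + √2 * x + 1) * (x ^ 2 - √2 * x + 1) := by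
    linear_combination x ^ 2 * h2
  have e4 : x ^ 2 + 1 = ((x ^ 2 + √2 * x + 1) + (x ^ 2 - √2 * x + 1)) / 2 := by ring
  rw [e1, e2, e3, e4]
  generalize x ^ 2 + √2 * x + 1 = a at p1 ⊢
  generalize x ^ 2 - √2 * x + 1 = b at p2 ⊢
  field_simp
  ring

theorem continuous_quarticAngle : Continuous quarticAngle :=
  continuous_iff_continuousAt.mpr fun x => (hasDerivAt_quarticAngle x).continuousAt

theorem sqrt_mul_sqrt_quartic (x : ℝ) :
    √(1 + (√2 * x + 1) ^ 2) * √(1 + (√2 * x - 1) ^ 2) = 2 * √(x ^ 4 + 1) := by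
  have h2 : √2 ^ 2 = 2 := sq_sqrt (by norm_num)
  rw [← sqrt_mul (by positivity), show (1 + (√2 * x + 1) ^ 2) * (1 + (√2 * x - 1) ^ 2) =
    2 ^ 2 * (x ^ 4 + 1) by linear_combination (x ^ 4 * (√2 ^ 2 + 2)) * h2,
    sqrt_mul (by positivity), sqrt_sq (by norm_num)]

theorem sin_quarticAngle (x : ℝ) : sin (quarticAngle x) = √2 * x / √(x ^ 4 + 1) := by
  rw [quarticAngle, sin_add, sin_arctan, cos_arctan, sin_arctan, cos_arctan, div_mul_div_comm,
    div_mul_div_comm, sqrt_mul_sqrt_quartic]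
  field_simp
  ring

theorem cos_quarticAngle (x : ℝ) : cos (quarticAngle x) = (1 - x ^ 2) / √(x ^ 4 + 1) := by
  have h2 : √2 ^ 2 = 2 := sq_sqrt (by norm_num)
  rw [quarticAngle, cos_add, sin_arctan, cos_arctan, sin_arctan, cos_arctan, div_mul_div_comm,
    div_mul_div_comm, sqrt_mul_sqrt_quartic]
  field_simp
  linear_combination -x ^ 2 * h2

theorem quarticAngle_zero : quarticAngle 0 = 0 := by
  simp [quarticAngle, arctan_neg]

theorem quarticAngle_one : quarticAngle 1 = π / 2 := by
  have h2 : √2 ^ 2 = 2 := sq_sqrt (by norm_num)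
  have h : √2 - 1 = (√2 + 1)⁻¹ := by
    refine eq_inv_of_mul_eq_one_left ?_
    linear_combination h2
  rw [quarticAngle, mul_one, h, arctan_inv_of_pos (by positivity)]
  ring

theorem continuous_quartic_weight : Continuous fun x : ℝ => (x ^ 2 + 1) / (x ^ 4 + 1) :=
  Continuous.div (by fun_prop) (by fun_prop) fun x => by positivity

theorem integral_comp_quarticAngle {g : ℝ → ℝ} (hg : Continuous g) :
    ∫ x in (0 : ℝ)..1, (x ^ 2 + 1) / (x ^ 4 + 1) * g (quarticAngle x) =
      (∫ t in (0 : ℝ)..π / 2, g t) / √2 := by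
  have h := intervalIntegral.integral_comp_mul_deriv (a := 0) (b := 1) (g := g)
    (fun x _ => hasDerivAt_quarticAngle x) (continuous_quartic_weight.const_mul √2).continuousOn hg
  rw [quarticAngle_zero, quarticAngle_one] at h
  rw [← h, eq_div_iff (by positivity), ← intervalIntegral.integral_mul_const]
  congr 1
  ext x
  simp only [Function.comp_apply]
  ring

theorem log_sin_quarticAngle {x : ℝ} (hx : 0 < x) :
    log (sin (quarticAngle x)) = log x + log 2 / 2 - log (x ^ 4 + 1) / 2 := by
  rw [sin_quarticAngle, log_div (by positivity) (by positivity), log_mul (by positivity) hx.ne',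
    log_sqrt (by positivity), log_sqrt (by positivity)]
  ring

theorem integral_quartic_weight :
    ∫ x in (0 : ℝ)..1, (x ^ 2 + 1) / (x ^ 4 + 1) = π / 2 / √2 := by
  simpa using integral_comp_quarticAngle (g := fun _ => 1) continuous_const

theorem strictMono_quarticAngle : StrictMono quarticAngle :=
  strictMono_of_deriv_pos fun y => by
    rw [(hasDerivAt_quarticAngle y).deriv]; positivity

theorem quarticAngle_mem_Ioo {x : ℝ} (hx : x ∈ Ioo (0 : ℝ) 1) :
    quarticAngle x ∈ Ioo 0 (π / 2) := by
  have h0 := strictMono_quarticAngle hx.1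
  have h1 := strictMono_quarticAngle hx.2
  rw [quarticAngle_zero] at h0
  rw [quarticAngle_one] at h1
  exact ⟨h0, h1⟩

theorem intervalIntegrable_weight_mul_log :
    IntervalIntegrable (fun x : ℝ => (x ^ 2 + 1) / (x ^ 4 + 1) * log x) volume 0 1 :=
  intervalIntegral.intervalIntegrable_log'.continuousOn_mul continuous_quartic_weight.continuousOn

theorem continuous_weight_mul_log_quartic :
    Continuous fun x : ℝ => (x ^ 2 + 1) / (x ^ 4 + 1) * log (x ^ 4 + 1) :=
  continuous_quartic_weight.mul (Continuous.log (by fun_prop) fun x => by positivity)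

/-- Since `log (sin θ(x)) = log x + log 2 / 2 - log (x ^ 4 + 1) / 2`, the two logarithmic integrals
are linked by the value of `∫ log sin` over `[0, π / 2]`. The integrands are unbounded at `0`, so
the substitution `t = θ(x)` is needed in its form for integrable functions. -/
theorem integral_weight_mul_log_quartic :
    ∫ x in (0 : ℝ)..1, (x ^ 2 + 1) / (x ^ 4 + 1) * log (x ^ 4 + 1) =
      2 * (∫ x in (0 : ℝ)..1, (x ^ 2 + 1) / (x ^ 4 + 1) * log x) + 3 * π * log 2 / (2 * √2) := by
  -- At `x = 0` the identity fails: both `log x` and `log (sin θ(x))` take the junk value `0`.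
  have hdec : ∀ x ∈ Ioc (0 : ℝ) 1,
      √2 * ((x ^ 2 + 1) / (x ^ 4 + 1) * log x
        + (x ^ 2 + 1) / (x ^ 4 + 1) * (log 2 / 2)
        - (x ^ 2 + 1) / (x ^ 4 + 1) * log (x ^ 4 + 1) / 2) =
      ((fun t => log (sin t)) ∘ quarticAngle) x * (√2 * ((x ^ 2 + 1) / (x ^ 4 + 1))) := by
    intro x hx
    simp only [Function.comp_apply, log_sin_quarticAngle hx.1]
    ring
  have hi1 := intervalIntegrable_weight_mul_log
  have hi2 := (continuous_quartic_weight.mul_const (log 2 / 2)).intervalIntegrable (μ := volume) 0 1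
  have hi3 := (continuous_weight_mul_log_quartic.div_const 2).intervalIntegrable (μ := volume) 0 1
  have hi := ((hi1.add hi2).sub hi3).const_mul √2
  have himage : quarticAngle '' Icc 0 1 ⊆ Icc 0 (π / 2) := by
    rintro _ ⟨x, hx, rfl⟩
    have hm := strictMono_quarticAngle.monotone
    exact ⟨quarticAngle_zero ▸ hm hx.1, quarticAngle_one ▸ hm hx.2⟩
  have hsub := intervalIntegral.integral_comp_mul_deriv''' (a := 0) (b := 1) (f := quarticAngle)
    (g := fun t => log (sin t)) continuous_quarticAngle.continuousOn
    (fun x _ => (hasDerivAt_quarticAngle x).hasDerivWithinAt) (by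
      rintro _ ⟨x, hx, rfl⟩
      rw [min_eq_left zero_le_one, max_eq_right zero_le_one] at hx
      have h := quarticAngle_mem_Ioo hx
      refine (continuous_sin.continuousAt.log ?_).continuousWithinAt
      exact (sin_pos_of_pos_of_lt_pi h.1 (by linarith [h.2, pi_pos])).ne') (by
      rw [uIcc_of_le zero_le_one]
      refine IntegrableOn.mono_set ?_ himage
      rw [← intervalIntegrable_iff_integrableOn_Icc_of_le (by positivity)]
      exact intervalIntegrable_log_sin) (by
      rw [uIcc_of_le zero_le_one, integrableOn_Icc_iff_integrableOn_Ioc]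
      exact ((intervalIntegrable_iff_integrableOn_Ioc_of_le zero_le_one).mp hi).congr_fun
        hdec measurableSet_Ioc)
  rw [quarticAngle_zero, quarticAngle_one, integral_log_sin_zero_pi_div_two,
    ← intervalIntegral.integral_congr_ae (Eventually.of_forall fun x hx =>
      hdec x (by rwa [uIoc_of_le zero_le_one] at hx)), intervalIntegral.integral_const_mul,
    intervalIntegral.integral_sub (hi1.add hi2) hi3, intervalIntegral.integral_add hi1 hi2,
    intervalIntegral.integral_mul_const, intervalIntegral.integral_div,
    integral_quartic_weight] at hsub
  have h2 : √2 ^ 2 = 2 := sq_sqrt (by norm_num)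
  field_simp at hsub ⊢
  linarith

/-! ### Reduction to a sum over the nodes -/

theorem quartic_factor_eq (β x : ℝ) :
    x ^ 4 + 1 - 2 * cos β * x ^ 2 = (x ^ 4 + 1) *
      (cos (quarticAngle x) ^ 2 + (√2 * sin (β / 2)) ^ 2 * sin (quarticAngle x) ^ 2) := by
  have h2 : √2 ^ 2 = 2 := sq_sqrt (by norm_num)
  have h4 : √(x ^ 4 + 1) ^ 2 = x ^ 4 + 1 := sq_sqrt (by positivity)
  have hb : (√2 * sin (β / 2)) ^ 2 = 1 - cos β := by
    rw [mul_pow, h2, sin_sq_eq_half_sub, mul_div_cancel₀ β two_ne_zero]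
    ring
  rw [hb, sin_quarticAngle, cos_quarticAngle, div_pow, div_pow, mul_pow, h2, h4]
  field_simp
  ring

theorem sin_node_pos {m j : ℕ} (hj : j < m) : 0 < sin ((2 * j + 1) * π / (2 * m) / 2) := by
  have hm : (0 : ℝ) < m := by exact_mod_cast (Nat.zero_le j).trans_lt hj
  have hjm : (j : ℝ) + 1 ≤ m := by exact_mod_cast hj
  refine sin_pos_of_pos_of_lt_pi (by positivity) ?_
  rw [div_div, div_lt_iff₀ (by positivity)]
  nlinarith [pi_pos]

/-- Splitting `log (x ^ (4 m) + 1)` into `m log (x ^ 4 + 1)` plus a sum of continuous functions of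
`θ(x)` leaves only trigonometric integrals and `∫ log x`. -/
theorem integral_eq_sum_log (m : ℕ) (hm : m ≠ 0) :
    ∫ x in (0 : ℝ)..1, (x ^ 2 + 1) * log (x ^ (4 * m) + 1) / (x ^ 4 + 1) =
      2 * m * (∫ x in (0 : ℝ)..1, (x ^ 2 + 1) / (x ^ 4 + 1) * log x) +
        π / √2 * ∑ j ∈ Finset.range m, log (√2 + 2 * sin ((2 * j + 1) * π / (2 * m) / 2)) := by
  set b : ℕ → ℝ := fun j => √2 * sin ((2 * j + 1) * π / (2 * m) / 2) with hb
  set g : ℕ → ℝ → ℝ := fun j t => log (cos t ^ 2 + b j ^ 2 * sin t ^ 2) with hg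
  have hbpos : ∀ j ∈ Finset.range m, 0 < b j := fun j hj =>
    mul_pos (by positivity) (sin_node_pos (Finset.mem_range.mp hj))
  have hgc : ∀ j ∈ Finset.range m, Continuous (g j) := fun j hj =>
    Continuous.log (by fun_prop) fun t => (cos_sq_add_mul_sin_sq_pos (hbpos j hj) t).ne'
  have hcongr : ∀ x ∈ Ioc (0 : ℝ) 1, (x ^ 2 + 1) * log (x ^ (4 * m) + 1) / (x ^ 4 + 1) =
      m * ((x ^ 2 + 1) / (x ^ 4 + 1) * log (x ^ 4 + 1)) +
        ∑ j ∈ Finset.range m, (x ^ 2 + 1) / (x ^ 4 + 1) * g j (quarticAngle x) := by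
    intro x hx
    rw [pow_add_one_eq_prod hm hx.1, Finset.prod_congr rfl fun j _ => quartic_factor_eq _ x,
      log_prod fun j hj => (mul_pos (by positivity)
        (cos_sq_add_mul_sin_sq_pos (hbpos j hj) (quarticAngle x))).ne',
      Finset.sum_congr rfl fun j hj => log_mul (by positivity)
        (cos_sq_add_mul_sin_sq_pos (hbpos j hj) (quarticAngle x)).ne',
      Finset.sum_add_distrib, Finset.sum_const, Finset.card_range, ← Finset.mul_sum, nsmul_eq_mul]
    ring
  have hi : ∀ j ∈ Finset.range m, IntervalIntegrable
      (fun x : ℝ => (x ^ 2 + 1) / (x ^ 4 + 1) * g j (quarticAngle x)) volume 0 1 := fun j hj =>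
    (continuous_quartic_weight.mul ((hgc j hj).comp continuous_quarticAngle)).intervalIntegrable _ _
  have hi0 := (continuous_weight_mul_log_quartic.const_mul (m : ℝ)).intervalIntegrable
    (μ := volume) 0 1
  have hval : ∀ j ∈ Finset.range m,
      ∫ x in (0 : ℝ)..1, (x ^ 2 + 1) / (x ^ 4 + 1) * g j (quarticAngle x) =
        π / √2 * (log (√2 + 2 * sin ((2 * j + 1) * π / (2 * m) / 2)) - 3 / 2 * log 2) := by
    intro j hj
    have hs := sin_node_pos (Finset.mem_range.mp hj)
    have hbj := hbpos j hj
    have h2 : √2 ^ 2 = 2 := sq_sqrt (by norm_num)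
    rw [integral_comp_quarticAngle (hgc j hj), integral_log_cos_sq_add_mul_sin_sq hbj,
      show √2 + 2 * sin ((2 * j + 1) * π / (2 * m) / 2) = √2 * (2 * ((1 + b j) / 2)) by
        simp only [hb]; linear_combination (-sin ((2 * j + 1) * π / (2 * m) / 2)) * h2,
      log_mul (by positivity) (by positivity), log_mul (by positivity) (by positivity),
      log_sqrt (by positivity)]
    ring
  rw [intervalIntegral.integral_congr_ae (Eventually.of_forall fun x hx =>
      hcongr x (by rwa [uIoc_of_le zero_le_one] at hx)),
    intervalIntegral.integral_add hi0
      (by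
        convert! IntervalIntegrable.sum _ hi using 1
        ext x
        rw [Finset.sum_apply]),
    intervalIntegral.integral_const_mul, intervalIntegral.integral_finsetSum hi,
    Finset.sum_congr rfl hval, integral_weight_mul_log_quartic, ← Finset.mul_sum,
    Finset.sum_sub_distrib, Finset.sum_const, Finset.card_range, nsmul_eq_mul]
  field_simp
  ring

/-! ### Pairing supplementary angles -/

theorem sqrt_one_sub_phi_div_two {m k : ℕ} (hk : k < m) :
    √((1 - phi m k) / 2) = sin ((2 * k + 1) * π / (2 * m)) := by
  have hm : (0 : ℝ) < m := by exact_mod_cast (Nat.zero_le k).trans_lt hk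
  have hkm : (k : ℝ) + 1 ≤ m := by exact_mod_cast hk
  have h : (1 - phi m k) / 2 = sin ((2 * k + 1) * π / (2 * m)) ^ 2 := by
    rw [sin_sq_eq_half_sub, phi,
      show 2 * ((2 * (k : ℝ) + 1) * π / (2 * m)) = (2 * k + 1) * π / m by field_simp]
    ring
  rw [h, sqrt_sq]
  refine sin_nonneg_of_nonneg_of_le_pi (by positivity) ?_
  rw [div_le_iff₀ (by positivity)]
  nlinarith [pi_pos]

theorem log_add_log_complementary {β : ℝ} (h0 : 0 < β) (h1 : β < π) :
    log (√2 + 2 * sin (β / 2)) + log (√2 + 2 * cos (β / 2)) =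
      log 2 + log (1 + sin β) / 2 + log (√2 + √(1 + sin β)) := by
  have hs : 0 < sin (β / 2) := sin_pos_of_pos_of_lt_pi (by linarith) (by linarith)
  have hc : 0 < cos (β / 2) := cos_pos_of_mem_Ioo ⟨by linarith, by linarith⟩
  have h2 : √2 ^ 2 = 2 := sq_sqrt (by norm_num)
  have hsin : sin β = 2 * sin (β / 2) * cos (β / 2) := by
    rw [← sin_two_mul, mul_div_cancel₀ β two_ne_zero]
  have hsc := sin_sq_add_cos_sq (β / 2)
  have hpos : 0 < 1 + sin β := by rw [hsin]; positivity
  have hr : √(1 + sin β) = sin (β / 2) + cos (β / 2) := by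
    rw [show 1 + sin β = (sin (β / 2) + cos (β / 2)) ^ 2 by linear_combination hsin - hsc,
      sqrt_sq (by positivity)]
  rw [← log_sqrt hpos.le, ← log_mul (by positivity) (by positivity),
    ← log_mul (by norm_num) (by positivity), ← log_mul (by positivity) (by positivity), hr]
  congr 1
  linear_combination h2 - 2 * hsc

/-- The nodes `k` and `m - 1 - k` carry supplementary angles. -/
theorem log_node_add_log_node_reflect {m k : ℕ} (hk : k < m) :
    log (√2 + 2 * sin ((2 * k + 1) * π / (2 * m) / 2)) +
        log (√2 + 2 * sin ((2 * (m - 1 - k : ℕ) + 1) * π / (2 * m) / 2)) =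
      log 2 + log (1 + √((1 - phi m k) / 2)) / 2 +
        log (√2 + √(1 + √((1 - phi m k) / 2))) := by
  have hm : (0 : ℝ) < m := by exact_mod_cast (Nat.zero_le k).trans_lt hk
  have hkm : (k : ℝ) + 1 ≤ m := by exact_mod_cast hk
  rw [sqrt_one_sub_phi_div_two hk, ← log_add_log_complementary (by positivity)]
  · rw [← sin_pi_div_two_sub, show m - 1 - k = m - (k + 1) by omega, Nat.cast_sub (by omega)]
    congr 5
    push_cast
    field_simp
    ring
  · rw [div_lt_iff₀ (by positivity)]
    nlinarith [pi_pos]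

theorem sum_range_two_mul_eq_sum_add_reflect (f : ℕ → ℝ) (n : ℕ) :
    ∑ j ∈ Finset.range (2 * n), f j = ∑ k ∈ Finset.range n, (f k + f (2 * n - 1 - k)) := by
  rw [two_mul, Finset.sum_range_add, Finset.sum_add_distrib,
    ← Finset.sum_range_reflect (fun k => f (n + k))]
  congr 1
  refine Finset.sum_congr rfl fun k hk => ?_
  have := Finset.mem_range.mp hk
  congr 1
  omega

theorem sum_range_two_mul_add_one_eq_sum_add_reflect (f : ℕ → ℝ) (n : ℕ) :
    ∑ j ∈ Finset.range (2 * n + 1), f j =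
      ∑ k ∈ Finset.range n, (f k + f (2 * n + 1 - 1 - k)) + f n := by
  rw [show 2 * n + 1 = n + (1 + n) by ring, Finset.sum_range_add, Finset.sum_range_add,
    Finset.sum_add_distrib, ← Finset.sum_range_reflect (fun k => f (n + (1 + k)))]
  have : ∑ j ∈ Finset.range n, f (n + (1 + (n - 1 - j))) =
      ∑ k ∈ Finset.range n, f (n + (1 + n) - 1 - k) := by
    refine Finset.sum_congr rfl fun k hk => ?_
    have := Finset.mem_range.mp hk
    congr 1
    omega
  rw [this]
  simp
  ring

theorem theorem2p6 (m : ℕ) :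
    (2 ≤ m → Even m →
      ∫ x in (0 : ℝ)..1, (x ^ 2 + 1) * Real.log (x ^ (4 * m) + 1) / (x ^ 4 + 1) =
        (m : ℝ) / 16 * (deriv psi (7 / 8) - deriv psi (3 / 8))
          - Real.pi ^ 2 * (m : ℝ) * Real.sqrt 2 / 8
          + Real.pi * (m : ℝ) * Real.sqrt 2 / 4 * Real.log 2
          + Real.pi * Real.sqrt 2 / 4 *
            (∑ k ∈ Finset.range (m / 2), Real.log (1 + Real.sqrt ((1 - phi m k) / 2))
              + 2 * ∑ k ∈ Finset.range (m / 2),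
                  Real.log (Real.sqrt 2 + Real.sqrt (1 + Real.sqrt ((1 - phi m k) / 2))))) ∧
    (1 ≤ m → Odd m →
      ∫ x in (0 : ℝ)..1, (x ^ 2 + 1) * Real.log (x ^ (4 * m) + 1) / (x ^ 4 + 1) =
        (m : ℝ) / 16 * (deriv psi (7 / 8) - deriv psi (3 / 8))
          - Real.pi ^ 2 * (m : ℝ) * Real.sqrt 2 / 8
          + Real.pi * ((m : ℝ) + 2) * Real.sqrt 2 / 4 * Real.log 2
          + Real.pi * Real.sqrt 2 / 4 *
            (∑ k ∈ Finset.range ((m - 1) / 2), Real.log (1 + Real.sqrt ((1 - phi m k) / 2))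
              + 2 * ∑ k ∈ Finset.range ((m - 1) / 2),
                  Real.log (Real.sqrt 2 + Real.sqrt (1 + Real.sqrt ((1 - phi m k) / 2))))) := by
  have hψ := deriv_psi_one_eighth_sub_five_eighths
  have hinv : π / √2 = π * √2 / 2 := by
    have h2 : √2 ^ 2 = 2 := sq_sqrt (by norm_num)
    field_simp
    linear_combination -h2
  refine ⟨fun hm2 hm => ?_, fun hm1 hm => ?_⟩
  · obtain ⟨n, rfl⟩ := even_iff_exists_two_mul.mp hm
    rw [integral_eq_sum_log _ (by omega), integral_mul_log_eq_deriv_psi, hinv,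
      sum_range_two_mul_eq_sum_add_reflect, Finset.sum_congr rfl fun k hk =>
        log_node_add_log_node_reflect (by have := Finset.mem_range.mp hk; omega),
      Finset.sum_add_distrib, Finset.sum_add_distrib, ← Finset.sum_div, Finset.sum_const,
      Finset.card_range, nsmul_eq_mul, Nat.mul_div_cancel_left n two_pos]
    push_cast
    linear_combination (-(n : ℝ) / 16) * hψ
  · obtain ⟨n, rfl⟩ := hm
    -- The middle node is its own reflection.
    have hmid : log (√2 + 2 * sin ((2 * n + 1) * π / (2 * (2 * n + 1 : ℕ)) / 2)) =
        3 / 2 * log 2 := by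
      rw [show (2 * (n : ℝ) + 1) * π / (2 * (2 * n + 1 : ℕ)) / 2 = π / 4 by
          push_cast; field_simp; norm_num, sin_pi_div_four,
        show √2 + 2 * (√2 / 2) = 2 * √2 by ring, log_mul (by norm_num) (by positivity),
        log_sqrt (by norm_num)]
      ring
    rw [integral_eq_sum_log _ (by omega), integral_mul_log_eq_deriv_psi, hinv,
      sum_range_two_mul_add_one_eq_sum_add_reflect, Finset.sum_congr rfl fun k hk =>
        log_node_add_log_node_reflect (by have := Finset.mem_range.mp hk; omega), hmid,
      Finset.sum_add_distrib, Finset.sum_add_distrib, ← Finset.sum_div, Finset.sum_const,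
      Finset.card_range, nsmul_eq_mul, show (2 * n + 1 - 1) / 2 = n by omega]
    push_cast
    linear_combination (-(2 * n + 1 : ℝ) / 32) * hψ
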